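/- All spaces are real. **$pn$-spaces.** Let $X$ be a Banach space, $Z$ a locally convex topological vector space, and $B\subseteq Z$ a Banach space, continuously embedded in $Z$. Let $G:D(G)\subseteq X\to Z$ be injective with $0\in D(G)$, $G(0)=0$, and put $\mathcal M_0=\{x\in D(G): G(x)\in B\}$. Assume that there are $K\in(0,\infty]$ and a convex function $\nu:\mathbb R\to[0,\infty]$ such that $\nu(\lambda)/|\lambda|$ tends to $c_0$ as $|\lambda|\to0$ and to $c_1$ as $|\lambda|\to K$, where $c_0=c_1=1$, or $c_0=0$ and $c_1=\infty$, and such that $\|G(\lambda x)\|_B\le\nu(\lambda)\|G(x)\|_B$ for all $x\in\mathcal M_0$, $\lambda\in\mathbb R$ (with $\|G(\lambda x)\|_B=\infty$ if $\lambda x\notin\mathcal M_0$). Let $\psi$ be a homeomorphism of $[0,\infty)$ with $\psi(0)=0$. The set $\mathcal M_0$ carries the $p$-norm $[x]=\psi^{-1}(\|G(x)\|_B)$, the metric $d(x_1,x_2)=\|G(x_1)-G(x_2)\|_B$, and the weak topology transported by $G$ from the weak topology of $B$ (so $x_m\rightharpoonup x_0$ in $\mathcal M_0$ means $G(x_m)\rightharpoonup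 G(x_0)$ in $B$). It is called weakly complete if $G(\mathcal M_0)$ is weakly closed in $B$, and "reflexive" if every weakly closed subset of $\mathcal M_0$ on which $[\cdot]$ is bounded is weakly compact in $\mathcal M_0$. **Hypotheses.** Let $Y$ be a Banach space with dual $Y^*$ and let $\mathcal M_0\subseteq X$ be a weakly complete $pn$-space as above. 1. $f:\mathcal M_0\to Y$ is weakly compact: whenever $x_m\rightharpoonup x_0$ in $\mathcal M_0$, there is a subsequence with $f(x_{m_k})\rightharpoonup f(x_0)$ weakly in $Y$. 2. $X_0\subseteq X$ is a topological space (with a topology of its own), $g:X_0\to Y^*$ is a mapping, $X_1\subseteq X_0\cap\mathcal M_0$ is dense in $X_0$ and in $\mathcal M_0$, and $\varphi:[0,\infty)\to\mathbb R$ is continuous, nondecreasing on $[\tau_0,\infty)$ for some $\tau_0\ge0$, with $\varphi(\tau_1)>0$ for some $\tau_1>0$, such that $$\langle f(x),g(x)\rangle\ge\varphi([x])\,[x]\qquad\text{for all }x\in X_1 .$$ Moreover one of the following holds: ($\alpha$) $\mathcal M_0$ is "reflexive"; $X_0=X_1\subseteq\mathcal M_0$ is a linear subspace of $X$ and, with its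 own topology, a separable topological vector space that is continuously and densely embedded in $\mathcal M_0$; $g=L$ is a continuous linear operator; and $\ker L^*=\{0\}$, that is, $y=0$ is the only $y\in Y$ with $\langle y,Lx\rangle=0$ for all $x\in X_0$; or ($\beta$) $Y$ is reflexive and separable; $g(X_1)$ contains a dense linear manifold of $Y^*$; $g$ is injective on $X_1$; and $g^{-1}$ is weakly compact from $Y^*$ to $\mathcal M_0$: if $x_m\in X_1$ and $g(x_m)\rightharpoonup\eta$ weakly in $Y^*$, then a subsequence of $(x_m)$ converges weakly in $\mathcal M_0$ to some $x_0\in\mathcal M_0$, and $x_0=x$ if $\eta=g(x)$ with $x\in X_1$. 3. There is a continuous $\varphi_1:[0,\infty)\to[0,\infty)$ such that $\|g(x)\|_{Y^*}\le\varphi_1([x])$ for all $x\in X_0\cap\mathcal M_0$, and $\varphi(\tau)\to+\infty$ and $\varphi(\tau)\tau/\varphi_1(\tau)\to+\infty$ as $\tau\to+\infty$. **Conclusion.** For every $y\in Y$ there is $x\in\mathcal M_0$ with $\langle f(x),y^*\rangle=\langle y,y^*\rangle$ for all $y^*\in Y^*$. -/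

import Mathlib

open Filter Topology Set
open scoped NNReal ENNReal

/-- Weak convergence of a sequence in a real normed space. -/
def WeaklyConverges {E : Type*} [NormedAddCommGroup E] [NormedSpace ℝ E]
    (u : ℕ → E) (a : E) : Prop :=
  Tendsto (fun m => toWeakSpace ℝ E (u m)) atTop (𝓝 (toWeakSpace ℝ E a))

/-- The admissible growth functions `ν : ℝ → [0, ∞]` with radius `K ∈ (0, ∞]`: `ν` is convex, and
`ν(l) / |l|` tends to `c₀` as `|l| → 0` and to `c₁` as `|l| → K`, where `c₀ = c₁ = 1`, or
`c₀ = 0` and `c₁ = ∞`. -/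
structure GrowthFunction (ν : ℝ → ℝ≥0∞) (K : ℝ≥0∞) : Prop where
  radius_pos : 0 < K
  convex : ConvexOn ℝ≥0 univ ν
  limits : ∃ c₀ c₁ : ℝ≥0∞, ((c₀ = 1 ∧ c₁ = 1) ∨ (c₀ = 0 ∧ c₁ = ∞)) ∧
    Tendsto (fun l : ℝ => ν l / ENNReal.ofReal |l|) (𝓝[≠] 0) (𝓝 c₀) ∧
    Tendsto (fun l : ℝ => ν l / ENNReal.ofReal |l|)
      (comap (fun l : ℝ => ENNReal.ofReal |l|) (𝓝[<] K)) (𝓝 c₁)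

/-- The data of a `pn`-space `𝓜 = {x ∈ D | G x ∈ B}` in `X`. Here `G : D → Z` is a mapping from a
subset `D` of `X` to a locally convex space `Z`, and `B ⊆ Z` is a Banach space with its own norm,
the inclusion being the continuous injective linear map `incl`. -/
structure PNSpace (X Z B : Type*) [AddCommGroup X] [Module ℝ X]
    [AddCommGroup Z] [Module ℝ Z] [TopologicalSpace Z]
    [NormedAddCommGroup B] [NormedSpace ℝ B] where
  /-- the inclusion of `B` in `Z` -/
  incl : B →L[ℝ] Z
  incl_injective : Function.Injective incl
  /-- the domain of the generating mapping -/
  dom : Set X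
  /-- the generating mapping; its values outside `dom` play no role -/
  gen : X → Z
  gen_injOn : InjOn gen dom
  zero_mem_dom : (0 : X) ∈ dom
  gen_zero : gen 0 = 0
  /-- `‖G (l x)‖_B ≤ ν(l) ‖G x‖_B` for all `x ∈ 𝓜` and all real `l`, in `[0, ∞]`:
  where `ν(l)` is finite this says in particular that `l x ∈ 𝓜`; where `ν(l) = ∞` it says
  nothing. -/
  gen_smul : ∃ (ν : ℝ → ℝ≥0∞) (K : ℝ≥0∞), GrowthFunction ν K ∧
    ∀ x ∈ dom, ∀ b : B, incl b = gen x → ∀ l : ℝ, ν l * ‖b‖ₑ ≠ ∞ →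
      l • x ∈ dom ∧ ∃ b' : B, incl b' = gen (l • x) ∧ ‖b'‖ₑ ≤ ν l * ‖b‖ₑ
  /-- the gauge relating the `p`-norm and the norm of `B` -/
  gauge : ℝ≥0 ≃ₜ ℝ≥0
  gauge_zero : gauge 0 = 0

namespace PNSpace

variable {X Z B : Type*} [AddCommGroup X] [Module ℝ X]
  [AddCommGroup Z] [Module ℝ Z] [TopologicalSpace Z]
  [NormedAddCommGroup B] [NormedSpace ℝ B]

/-- The underlying subset `𝓜` of `X`. -/
def carrier (M : PNSpace X Z B) : Set X := {x | x ∈ M.dom ∧ ∃ b : B, M.incl b = M.gen x}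

/-- The points of `𝓜`. -/
def Pt (M : PNSpace X Z B) : Type _ := {x : X // x ∈ M.carrier}

/-- The value `G x`, as an element of `B`. -/
noncomputable def toB (M : PNSpace X Z B) (x : M.Pt) : B := x.2.2.choose

theorem incl_toB (M : PNSpace X Z B) (x : M.Pt) : M.incl (M.toB x) = M.gen x.1 :=
  x.2.2.choose_spec

theorem toB_injective (M : PNSpace X Z B) : Function.Injective M.toB := by
  intro x y h
  apply Subtype.ext
  apply M.gen_injOn x.2.1 y.2.1
  rw [← M.incl_toB x, ← M.incl_toB y, h]

/-- The metric `d(x₁, x₂) = ‖G x₁ - G x₂‖_B` of `𝓜`. -/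
noncomputable instance (M : PNSpace X Z B) : MetricSpace M.Pt :=
  MetricSpace.induced M.toB M.toB_injective inferInstance

/-- The `p`-norm `[x] = ψ⁻¹(‖G x‖_B)`. -/
noncomputable def pnorm (M : PNSpace X Z B) (x : M.Pt) : ℝ≥0 := M.gauge.symm ‖M.toB x‖₊

/-- The weak topology of `𝓜`, transported from the weak topology of `B` by `G`. -/
@[reducible] noncomputable def weakTopology (M : PNSpace X Z B) : TopologicalSpace M.Pt :=
  TopologicalSpace.induced (fun x => toWeakSpace ℝ B (M.toB x)) inferInstance

/-- Convergence of a sequence in the weak topology of `𝓜`. -/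
def WeakConv (M : PNSpace X Z B) (u : ℕ → M.Pt) (a : M.Pt) : Prop :=
  Tendsto u atTop (@nhds M.Pt M.weakTopology a)

theorem weakConv_iff (M : PNSpace X Z B) (u : ℕ → M.Pt) (a : M.Pt) :
    M.WeakConv u a ↔ WeaklyConverges (fun m => M.toB (u m)) (M.toB a) := by
  unfold WeakConv WeaklyConverges weakTopology
  rw [nhds_induced, tendsto_comap_iff]
  rfl

/-- `𝓜` is weakly complete: `G(𝓜)` is weakly closed in `B`. -/
def WeaklyComplete (M : PNSpace X Z B) : Prop :=
  IsClosed (range fun x : M.Pt => toWeakSpace ℝ B (M.toB x))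

/-- `𝓜` is "reflexive": each bounded weakly closed subset of `𝓜` is weakly compact in `𝓜`. -/
def IsReflexive (M : PNSpace X Z B) : Prop :=
  ∀ A : Set M.Pt, (∃ R : ℝ≥0, ∀ x ∈ A, M.pnorm x ≤ R) →
    IsClosed[M.weakTopology] A → @IsCompact M.Pt M.weakTopology A

end PNSpace

section Conditions

variable {X Z B Y E₀ : Type*} [AddCommGroup X] [Module ℝ X]
  [AddCommGroup Z] [Module ℝ Z] [TopologicalSpace Z]
  [NormedAddCommGroup B] [NormedSpace ℝ B]
  [NormedAddCommGroup Y] [NormedSpace ℝ Y] [TopologicalSpace E₀]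

/-- `f : 𝓜 → Y` is weakly compact (weakly "continuous"): whenever `x_m ⇀ x₀` in `𝓜`, a
subsequence of `f(x_m)` converges to `f(x₀)` weakly in `Y`. -/
def WeaklyCompactMap (M : PNSpace X Z B) (f : M.Pt → Y) : Prop :=
  ∀ (x : ℕ → M.Pt) (x₀ : M.Pt), M.WeakConv x x₀ →
    ∃ k : ℕ → ℕ, StrictMono k ∧ WeaklyConverges (fun m => f (x (k m))) (f x₀)

/-- `f` and `g : X₀ → Y*` form a coercive pair in the generalized sense on `X₁ ⊆ X₀ ∩ 𝓜`,
with the function `φ`, where `X₁` is dense both in `X₀` and in `𝓜`. The space `X₀ ⊆ X`, with a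
topology of its own, is given by the type `E₀` and its inclusion `j` in `X`. -/
structure CoercivePair (M : PNSpace X Z B) (f : M.Pt → Y) (j : E₀ → X)
    (g : E₀ → StrongDual ℝ Y) (X₁ : Set E₀) (φ : ℝ≥0 → ℝ) : Prop where
  incl_injective : Function.Injective j
  continuous_phi : Continuous φ
  monotone_phi : ∃ τ₀ : ℝ≥0, MonotoneOn φ (Ici τ₀)
  phi_pos : ∃ τ₁ : ℝ≥0, 0 < τ₁ ∧ 0 < φ τ₁
  subset : ∀ e ∈ X₁, j e ∈ M.carrier
  dense_left : Dense X₁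
  dense_right : Dense {x : M.Pt | ∃ e ∈ X₁, j e = x.1}
  coercive : ∀ e ∈ X₁, ∀ x : M.Pt, x.1 = j e → φ (M.pnorm x) * M.pnorm x ≤ g e (f x)

/-- The linear alternative: `𝓜` is "reflexive", `X₀ = X₁ ⊆ 𝓜` is a separable topological vector
space, continuously embedded in `𝓜` (it is dense there by `CoercivePair`), and `g` is a
continuous linear operator `L` with `ker L* = {0}`, where `L* : Y → X₀*` is the adjoint with
respect to the duality of `Y` and `Y*`. -/
def LinearAlternative (M : PNSpace X Z B) (j : E₀ → X) (g : E₀ → StrongDual ℝ Y)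
    (X₁ : Set E₀) : Prop :=
  M.IsReflexive ∧ X₁ = univ ∧
  (∃ ι : E₀ → M.Pt, Continuous ι ∧ ∀ e, (ι e).1 = j e) ∧
  TopologicalSpace.SeparableSpace E₀ ∧
  ∃ (_ : AddCommGroup E₀) (_ : Module ℝ E₀) (_ : IsTopologicalAddGroup E₀)
    (_ : ContinuousSMul ℝ E₀), IsLinearMap ℝ j ∧
    ∃ L : E₀ →L[ℝ] StrongDual ℝ Y, (∀ e, L e = g e) ∧ ∀ y : Y, (∀ e, L e y = 0) → y = 0

/-- The nonlinear alternative: `Y` is reflexive and separable, `g(X₁)` contains a dense linear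
manifold of `Y*`, `g` is invertible, and `g⁻¹` is weakly compact from `Y*` to `𝓜`: whenever
`y_m ∈ g(X₁)` converges weakly in `Y*` to `η`, a subsequence of `g⁻¹(y_m)` converges weakly in
`𝓜`, the limit being `g⁻¹(η)` if `η ∈ g(X₁)`. (It is not required that `g(X₁)` or `g(X₀)` be the
whole of `Y*`.) -/
def NonlinearAlternative (M : PNSpace X Z B) (j : E₀ → X) (g : E₀ → StrongDual ℝ Y)
    (X₁ : Set E₀) : Prop :=
  Function.Surjective (NormedSpace.inclusionInDoubleDual ℝ Y) ∧
  TopologicalSpace.SeparableSpace Y ∧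
  (∃ D : Submodule ℝ (StrongDual ℝ Y), Dense (D : Set (StrongDual ℝ Y)) ∧
    (D : Set (StrongDual ℝ Y)) ⊆ g '' X₁) ∧
  InjOn g X₁ ∧
  ∀ (e : ℕ → E₀) (x : ℕ → M.Pt) (η : StrongDual ℝ Y), (∀ m, e m ∈ X₁ ∧ (x m).1 = j (e m)) →
    WeaklyConverges (fun m => g (e m)) η →
    ∃ k : ℕ → ℕ, StrictMono k ∧ ∃ x₀ : M.Pt, M.WeakConv (fun m => x (k m)) x₀ ∧
      ∀ e₀ ∈ X₁, g e₀ = η → x₀.1 = j e₀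

end Conditions

/-! The proof is a Galerkin argument. Since `φ(τ)τ/φ₁(τ) → ∞`, the pairing of `f(x) - y` with `g(x)`
is positive once `[x]` exceeds some `R`. A finite-dimensional space of functionals inside `g(X₁)` is
parametrized by a Euclidean space; pairing `f - y` with these functionals gives a continuous vector
field with nonnegative radial component on a large sphere, so it has a zero by Brouwer's theorem.
Positivity beyond `R` then forces `[x_n] ≤ R` for the approximate solutions, uniformly in the
dimension.

"Reflexivity" of `𝓜₀`, or weak compactness of `g⁻¹`, yields a weakly convergent subsequence of
`(x_n)`. Weak compactness of `f` carries the Galerkin equations to the limit `x₀`, and the test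
functionals separate the points of `Y`, whence `f(x₀) = y`.

The alternatives differ in how large spheres reach `[x] ≥ R`: through the growth function `ν` in the
linear case (`PNSpace.exists_smul_norm_le`), through `‖g‖ ≤ φ₁` in the nonlinear one. -/

theorem exists_weights_eval_one (n : ℕ) {t₀ : ℝ} (ht₀ : 0 < t₀) :
    ∃ t w : Fin (n + 1) → ℝ, (∀ i, 0 < t i ∧ t i < t₀) ∧
      ∀ p : Polynomial ℝ, p.natDegree ≤ n → p.eval 1 = ∑ i, p.eval (t i) * w i := by
  have hinj : Function.Injective fun i : Fin (n + 1) => t₀ / (i + 2 : ℝ) := by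
    intro i k h
    have hi : (0 : ℝ) < (i : ℝ) + 2 := by positivity
    have hk : (0 : ℝ) < (k : ℝ) + 2 := by positivity
    have h' : t₀ * ((k : ℝ) + 2) = t₀ * (i + 2) := (div_eq_div_iff hi.ne' hk.ne').1 h
    have := mul_left_cancel₀ ht₀.ne' h'
    apply Fin.ext
    have h2 : (k : ℝ) = i := by linarith
    exact_mod_cast h2.symm
  refine ⟨fun i => t₀ / (i + 2 : ℝ), fun i => (Lagrange.basis Finset.univ
    (fun i : Fin (n + 1) => t₀ / (i + 2 : ℝ)) i).eval 1, fun i => ⟨by positivity, ?_⟩, ?_⟩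
  · refine div_lt_self ht₀ ?_
    have : (0 : ℝ) ≤ i := by positivity
    linarith
  · intro p hp
    have hdeg : p.degree < (Finset.univ : Finset (Fin (n + 1))).card := by
      rw [Finset.card_univ, Fintype.card_fin]
      exact lt_of_le_of_lt Polynomial.degree_le_natDegree (by exact_mod_cast Nat.lt_succ_of_le hp)
    conv_lhs => rw [Lagrange.eq_interpolate (hinj.injOn) hdeg]
    simp [Lagrange.interpolate_apply, Polynomial.eval_finsetSum]

/-! ### Brouwer's theorem, from a volume argument against retractions. -/

section Retraction

variable {E : Type*} [NormedAddCommGroup E] [InnerProductSpace ℝ E] [FiniteDimensional ℝ E]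

theorem exists_polynomial_det_one_add_smul (A : E →L[ℝ] E) :
    ∃ p : Polynomial ℝ, p.natDegree ≤ Module.finrank ℝ E ∧
      ∀ t : ℝ, p.eval t = (1 + t • A).det := by
  let b := Module.finBasis ℝ E
  let M := LinearMap.toMatrix b b (A : E →ₗ[ℝ] E)
  refine ⟨Matrix.det ((Polynomial.X : Polynomial ℝ) • M.map Polynomial.C
    + (1 : Matrix _ _ ℝ).map Polynomial.C), ?_, ?_⟩
  · simpa using Polynomial.natDegree_det_X_add_C_le M 1
  · intro t
    have h1 : (1 + t • A).det = LinearMap.det (1 + t • (A : E →ₗ[ℝ] E)) := rfl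
    rw [h1, ← LinearMap.det_toMatrix b, ← Polynomial.coe_evalRingHom, RingHom.map_det]
    congr 1
    ext i k
    by_cases hik : i = k <;> simp [M, hik, LinearMap.toMatrix_one] <;> ring

theorem det_one_add_smul_pos {A : E →L[ℝ] E} {t : ℝ} (ht : 0 ≤ t) (h : t * ‖A‖ < 1) :
    0 < (1 + t • A).det := by
  by_contra hneg
  have hc : ContinuousOn (fun s : ℝ => (1 + s • A).det) (Icc 0 t) :=
    (ContinuousLinearMap.continuous_det.comp (by fun_prop)).continuousOn
  obtain ⟨s, hs, hs0⟩ := intermediate_value_Icc' ht hc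
    (show (0 : ℝ) ∈ Icc _ _ from ⟨not_lt.1 hneg, by simp [ContinuousLinearMap.det]⟩)
  have hlt : ‖-(s • A)‖ < 1 := by
    rw [norm_neg, norm_smul, Real.norm_of_nonneg hs.1]
    exact lt_of_le_of_lt (mul_le_mul_of_nonneg_right hs.2 (norm_nonneg _)) h
  have hu : IsUnit (1 + s • A) := by
    simpa using isUnit_one_sub_of_norm_lt_one hlt
  have : IsUnit (1 + s • A).det := by
    have := hu.map (ContinuousLinearMap.toLinearMapRingHom : (E →L[ℝ] E) →+* _)
    exact LinearMap.isUnit_det _ this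
  exact this.ne_zero hs0

/-- For small `t` the map `id + t(ρ - id)` is a bijection of the ball, so the integral of its
Jacobian is the volume of the ball. The Jacobian is polynomial in `t`, so the identity extends to `t
= 1`, where a vanishing `det ρ'` would make the volume zero. -/
theorem exists_det_fderiv_ne_zero_of_eq_id_on_sphere {r : ℝ} (hr : 0 < r) {ρ : E → E}
    {ρ' : E → E →L[ℝ] E} (hρ : ∀ x ∈ Metric.closedBall (0 : E) r, HasFDerivAt ρ (ρ' x) x)
    (hρ' : ContinuousOn ρ' (Metric.closedBall 0 r)) (hid : ∀ x, ‖x‖ = r → ρ x = x) :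
    ∃ x ∈ Metric.closedBall (0 : E) r, (ρ' x).det ≠ 0 := by
  by_contra! hdet
  set K := Metric.closedBall (0 : E) r with hK
  have hKc : IsCompact K := isCompact_closedBall 0 r
  have hconv : Convex ℝ K := convex_closedBall 0 r
  borelize E
  obtain ⟨C₀, hC₀⟩ := hKc.exists_bound_of_continuousOn (hρ'.sub (continuousOn_const (c := 1)))
  set C : ℝ≥0 := Real.toNNReal C₀ with hCdef
  have hC : ∀ x ∈ K, ‖ρ' x - 1‖₊ ≤ C := fun x hx => by
    rw [← NNReal.coe_le_coe]
    exact (hC₀ x hx).trans (Real.le_coe_toNNReal _)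
  have hlipK : LipschitzOnWith C (fun x => ρ x - x) K :=
    hconv.lipschitzOnWith_of_nnnorm_hasFDerivWithin_le
      (fun x hx => ((hρ x hx).sub (hasFDerivAt_id x)).hasFDerivWithinAt) hC
  classical
  set h : E → E := fun x => if x ∈ K then ρ x - x else 0 with hh
  have hout : ∀ x ∉ K, h x = 0 := fun x hx => by simp [hh, hx]
  -- The segment from `x` to `y` meets the sphere, where `ρ - id` vanishes.
  have hcross : ∀ x ∈ K, ∀ y ∉ K, ‖h x - h y‖ ≤ C * ‖x - y‖ := by
    intro x hx y hy
    have hcont : ContinuousOn (fun s : ℝ => ‖AffineMap.lineMap x y s‖) (Icc 0 1) := by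
      have : Continuous fun s : ℝ => AffineMap.lineMap x y s := AffineMap.lineMap_continuous
      exact this.norm.continuousOn
    obtain ⟨s, hs, hsr⟩ := intermediate_value_Icc zero_le_one hcont (show r ∈ Icc _ _ by
      constructor
      · simpa [hK] using hx
      · simpa [hK] using le_of_lt (by simpa [hK] using hy))
    set z := AffineMap.lineMap x y s with hz
    have hzK : z ∈ K := by simpa [hK] using le_of_eq hsr
    have hxz : ‖x - z‖ ≤ ‖x - y‖ := by
      rw [← dist_eq_norm, dist_comm, hz, dist_lineMap_left, Real.norm_of_nonneg hs.1,
        ← dist_eq_norm]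
      exact mul_le_of_le_one_left dist_nonneg hs.2
    have h1 := hlipK.norm_sub_le hx hzK
    have hz0 : ρ z - z = 0 := by rw [hid z hsr, sub_self]
    rw [hz0, sub_zero] at h1
    rw [hout y hy, sub_zero]
    simp only [hh, if_pos hx]
    exact h1.trans (by gcongr)
  have hlip : ∀ x y, ‖h x - h y‖ ≤ C * ‖x - y‖ := by
    intro x y
    by_cases hx : x ∈ K <;> by_cases hy : y ∈ K
    · simpa [hh, hx, hy] using hlipK.norm_sub_le hx hy
    · exact hcross x hx y hy
    · rw [norm_sub_rev, norm_sub_rev x]; exact hcross y hy x hx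
    · simp only [hout x hx, hout y hy, sub_self, norm_zero]; positivity
  have hpos : (0 : ℝ) < 1 / (C + 1) := by positivity
  have hvol : ∀ t : ℝ, 0 < t → t < 1 / (C + 1) →
      ∫ x in K, (1 + t • (ρ' x - 1)).det = MeasureTheory.volume.real K := by
    intro t ht htC
    have htC1 : t * C < 1 := by
      rw [lt_div_iff₀ (by positivity)] at htC
      nlinarith
    let e := ContinuousLinearEquiv.refl ℝ E
    set φ : E → E := fun x => x + t • h x with hφ
    have happ : ApproximatesLinearOn φ (e : E →L[ℝ] E) univ (Real.toNNReal (t * C)) := by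
      intro x _ y _
      have : φ x - φ y - (e : E →L[ℝ] E) (x - y) = t • (h x - h y) := by
        simp only [hφ, e, smul_sub]
        simp
        abel
      rw [this, norm_smul, Real.norm_of_nonneg ht.le, Real.coe_toNNReal _ (by positivity), mul_assoc]
      exact mul_le_mul_of_nonneg_left (hlip x y) ht.le
    have hc : Subsingleton E ∨ Real.toNNReal (t * C) < ‖(e.symm : E →L[ℝ] E)‖₊⁻¹ := by
      rcases subsingleton_or_nontrivial E with hE | hE
      · exact Or.inl hE
      · right
        have : ‖(e.symm : E →L[ℝ] E)‖₊ = 1 := by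
          apply NNReal.eq
          exact ContinuousLinearMap.norm_id
        rw [this, inv_one, Real.toNNReal_lt_one]
        exact htC1
    have hinj : Function.Injective φ := injOn_univ.1 (happ.injOn hc)
    have hsurj : Function.Surjective φ := happ.surjective hc
    have hfix : ∀ x ∉ K, φ x = x := fun x hx => by simp [hφ, hout x hx]
    -- A bijection fixing every point outside `K` must preserve `K`.
    have himg : φ '' K = K := by
      have h1 : φ '' Kᶜ = Kᶜ := by
        rw [show φ '' Kᶜ = id '' Kᶜ from image_congr fun x hx => hfix x hx, image_id]
      rw [← compl_inj_iff, ← image_compl_eq ⟨hinj, hsurj⟩, h1]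
    have hder : ∀ x ∈ K, HasFDerivWithinAt φ (1 + t • (ρ' x - 1)) K x := by
      intro x hx
      have h1 : HasFDerivWithinAt (fun x => x + t • (ρ x - x)) (1 + t • (ρ' x - 1)) K x :=
        ((hasFDerivAt_id x).add (((hρ x hx).sub (hasFDerivAt_id x)).const_smul t)).hasFDerivWithinAt
      exact h1.congr (fun y hy => by simp [hφ, hh, hy]) (by simp [hφ, hh, hx])
    have := MeasureTheory.integral_image_eq_integral_abs_det_fderiv_smul MeasureTheory.volume
      hKc.measurableSet hder hinj.injOn (fun _ => (1 : ℝ))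
    rw [himg] at this
    simp only [smul_eq_mul, mul_one, MeasureTheory.integral_const,
      MeasureTheory.measureReal_restrict_apply_univ] at this
    rw [this]
    refine MeasureTheory.setIntegral_congr_fun hKc.measurableSet fun x hx => ?_
    refine (abs_of_pos (det_one_add_smul_pos ht.le (lt_of_le_of_lt ?_ htC1))).symm
    exact mul_le_mul_of_nonneg_left (hC x hx) ht.le
  -- Interpolation at small nodes expresses the Jacobian at `t = 1` with weights independent of `x`,
  -- so it can be integrated termwise.
  obtain ⟨t, w, ht, hw⟩ := exists_weights_eval_one (Module.finrank ℝ E) hpos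
  have hint : ∀ s : ℝ, MeasureTheory.IntegrableOn (fun x => (1 + s • (ρ' x - 1)).det) K := by
    intro s
    refine ContinuousOn.integrableOn_compact hKc ?_
    exact ContinuousLinearMap.continuous_det.comp_continuousOn
      (continuousOn_const.add ((hρ'.sub continuousOn_const).const_smul s))
  have hsum : ∀ x ∈ K, (0 : ℝ) = ∑ i, (1 + t i • (ρ' x - 1)).det * w i := by
    intro x hx
    obtain ⟨p, hp, hpe⟩ := exists_polynomial_det_one_add_smul (ρ' x - 1)
    have := hw p hp
    simp only [hpe, one_smul, add_sub_cancel, hdet x hx] at this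
    exact this
  have hw1 : (1 : ℝ) = ∑ i, w i := by simpa using hw 1 (by simp)
  have hzero : (0 : ℝ) = ∑ i, MeasureTheory.volume.real K * w i := by
    calc (0 : ℝ) = ∫ x in K, (0 : ℝ) := by simp
      _ = ∫ x in K, ∑ i, (1 + t i • (ρ' x - 1)).det * w i :=
        MeasureTheory.setIntegral_congr_fun hKc.measurableSet fun x hx => hsum x hx
      _ = ∑ i, ∫ x in K, (1 + t i • (ρ' x - 1)).det * w i :=
        MeasureTheory.integral_finsetSum _ fun i _ => (hint (t i)).mul_const (w i)
      _ = _ := by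
        refine Finset.sum_congr rfl fun i _ => ?_
        rw [MeasureTheory.integral_mul_const, hvol _ (ht i).1 (ht i).2]
  rw [← Finset.mul_sum, ← hw1, mul_one] at hzero
  have hKpos : 0 < MeasureTheory.volume.real K :=
    ENNReal.toReal_pos (Metric.measure_closedBall_pos _ _ hr).ne' hKc.measure_lt_top.ne
  exact hKpos.ne hzero

open scoped RealInnerProductSpace

/-- Without a zero, pushing `x` along `F x` until it reaches the sphere is a `C¹` map onto the
sphere that fixes it. Its values have constant norm, so its derivative cannot be surjective. -/
theorem ContDiff.exists_zero_of_inner_pos_on_sphere {r : ℝ} (hr : 0 < r) {F : E → E}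
    (hF : ContDiff ℝ 1 F) (hpos : ∀ x, ‖x‖ = r → 0 < ⟪F x, x⟫) :
    ∃ x ∈ Metric.closedBall (0 : E) r, F x = 0 := by
  by_contra! hne
  set disc : E → ℝ := fun x => ⟪F x, x⟫ ^ 2 + ‖F x‖ ^ 2 * (r ^ 2 - ‖x‖ ^ 2) with hdisc
  -- The larger root of `‖x + s F x‖² = r²`; it is `0` on the sphere because `⟪F x, x⟫ > 0` there.
  set s : E → ℝ := fun x => (√(disc x) - ⟪F x, x⟫) / ‖F x‖ ^ 2 with hs
  set ρ : E → E := fun x => x + s x • F x with hρ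
  have hdc : ContDiff ℝ 1 disc :=
    ((hF.inner ℝ contDiff_id).pow 2).add
      ((hF.norm_sq ℝ).mul (contDiff_const.sub (contDiff_norm_sq ℝ)))
  have hdpos : ∀ x ∈ Metric.closedBall (0 : E) r, 0 < disc x := by
    intro x hx
    have hxr : ‖x‖ ≤ r := by simpa using hx
    have hF0 : 0 < ‖F x‖ := norm_pos_iff.2 (hne x hx)
    rcases hxr.lt_or_eq with hlt | heq
    · have : 0 < r ^ 2 - ‖x‖ ^ 2 := by nlinarith [norm_nonneg x]
      simp only [hdisc]; positivity
    · have := hpos x heq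
      simp only [hdisc, heq, sub_self, mul_zero, add_zero]; positivity
  have hsmooth : ∀ x ∈ Metric.closedBall (0 : E) r, ContDiffAt ℝ 1 ρ x := by
    intro x hx
    refine contDiffAt_id.add (ContDiffAt.smul (ContDiffAt.div ?_ ?_ ?_) hF.contDiffAt)
    · exact (hdc.contDiffAt.sqrt (hdpos x hx).ne').sub (hF.inner ℝ contDiff_id).contDiffAt
    · exact (hF.norm_sq ℝ).contDiffAt
    · exact pow_ne_zero 2 (norm_ne_zero_iff.2 (hne x hx))
  have hnorm : ∀ x, 0 ≤ disc x → F x ≠ 0 → ⟪ρ x, ρ x⟫ = r ^ 2 := by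
    intro x hd hF0
    have hb : ‖F x‖ ^ 2 ≠ 0 := pow_ne_zero 2 (norm_ne_zero_iff.2 hF0)
    have h1 : s x * ‖F x‖ ^ 2 = √(disc x) - ⟪F x, x⟫ := div_mul_cancel₀ _ hb
    have h2 : √(disc x) ^ 2 = disc x := Real.sq_sqrt hd
    have h3 : ⟪ρ x, ρ x⟫ = ‖x‖ ^ 2 + 2 * s x * ⟪F x, x⟫ + s x ^ 2 * ‖F x‖ ^ 2 := by
      simp only [hρ, inner_add_left, inner_add_right, inner_smul_left, inner_smul_right,
        real_inner_self_eq_norm_sq, real_inner_comm (F x) x]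
      simp
      ring
    have h4 : (s x * ‖F x‖ ^ 2 + ⟪F x, x⟫) ^ 2 = disc x := by
      rw [h1, sub_add_cancel, h2]
    rw [h3]
    apply mul_left_cancel₀ hb
    simp only [hdisc] at h4
    linear_combination h4
  obtain ⟨x, hx, hx0⟩ := exists_det_fderiv_ne_zero_of_eq_id_on_sphere hr (ρ := ρ)
    (ρ' := fderiv ℝ ρ)
    (fun x hx => ((hsmooth x hx).differentiableAt one_ne_zero).hasFDerivAt)
    (fun x hx => ((hsmooth x hx).fderiv_right (m := 0) (by simp)).continuousAt.continuousWithinAt)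
    (by
      intro x hx
      have hd : disc x = ⟪F x, x⟫ ^ 2 := by simp [hdisc, hx]
      have : s x = 0 := by simp [hs, hd, Real.sqrt_sq (hpos x hx).le]
      simp [hρ, this])
  have hρd := ((hsmooth x hx).differentiableAt one_ne_zero).hasFDerivAt
  have hev : (fun y => ⟪ρ y, ρ y⟫) =ᶠ[𝓝 x] fun _ => r ^ 2 := by
    filter_upwards [hdc.continuous.continuousAt.eventually (lt_mem_nhds (hdpos x hx)),
      hF.continuous.continuousAt.eventually_ne (hne x hx)] with y hy hy'
    exact hnorm y (le_of_lt hy) hy'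
  have hderiv := (hρd.inner ℝ hρd).unique ((hasFDerivAt_const (r ^ 2) x).congr_of_eventuallyEq hev)
  have horth : ∀ v, ⟪ρ x, fderiv ℝ ρ x v⟫ = 0 := by
    intro v
    have := congrArg (fun T : E →L[ℝ] ℝ => T v) hderiv
    simp [fderivInnerCLM_apply, real_inner_comm] at this
    linarith
  have hsurj : Function.Surjective (fderiv ℝ ρ x) := by
    have hu : IsUnit (LinearMap.det (fderiv ℝ ρ x : E →ₗ[ℝ] E)) := isUnit_iff_ne_zero.2 hx0
    exact (LinearEquiv.ofIsUnitDet (v := Module.finBasis ℝ E) (v' := Module.finBasis ℝ E)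
      (f := (fderiv ℝ ρ x : E →ₗ[ℝ] E)) (by rwa [LinearMap.det_toMatrix])).surjective
  obtain ⟨v, hv⟩ := hsurj (ρ x)
  have h0 := horth v
  rw [hv, hnorm x (hdpos x hx).le (hne x hx)] at h0
  exact (pow_pos hr 2).ne' h0

/-- A form of the **Brouwer fixed point theorem**: a continuous vector field that does not point
inwards on a sphere has a zero in the ball. -/
theorem Continuous.exists_zero_of_inner_nonneg_on_sphere {r : ℝ} (hr : 0 < r) {F : E → E}
    (hF : Continuous F) (hpos : ∀ x, ‖x‖ = r → 0 ≤ ⟪F x, x⟫) :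
    ∃ x ∈ Metric.closedBall (0 : E) r, F x = 0 := by
  by_contra! hne
  obtain ⟨z, hz, hmin⟩ := (isCompact_closedBall (0 : E) r).exists_isMinOn
    ⟨0, Metric.mem_closedBall_self hr.le⟩ hF.norm.continuousOn
  set δ := ‖F z‖ with hδ
  have hδ0 : 0 < δ := norm_pos_iff.2 (hne z hz)
  -- The added radial term contributes `δr/2` on the sphere, beating the error `δr/4`; at a zero of
  -- `P` one gets `‖F x‖ < δ/4 + δ/2 < δ`, against minimality.
  obtain ⟨P, hP, hPd, -⟩ := (hF.add (continuous_id.const_smul (δ / (2 * r)))).exists_contDiff_approx 1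
    (ε := fun _ => δ / 4) continuous_const (fun _ => by positivity)
  obtain ⟨x, hx, hx0⟩ := hP.exists_zero_of_inner_pos_on_sphere hr (fun x hx => by
    have h1 := hPd x
    simp only [dist_eq_norm, Pi.add_apply, Pi.smul_apply, id] at h1
    set D := P x - (F x + (δ / (2 * r)) • x) with hD
    have h2 : P x = F x + (δ / (2 * r)) • x + D := by rw [hD]; abel
    rw [h2, inner_add_left, inner_add_left, real_inner_smul_left, real_inner_self_eq_norm_sq, hx]
    have h3 := abs_le.1 (abs_real_inner_le_norm D x)
    rw [hx] at h3
    have h4 : δ / (2 * r) * r ^ 2 = δ / 2 * r := by field_simp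
    have h5 : ‖D‖ * r < δ / 4 * r := mul_lt_mul_of_pos_right h1 hr
    have h6 : 0 < δ * r := by positivity
    have := hpos x hx
    linarith [h3.1])
  have h1 := hPd x
  simp only [dist_eq_norm, Pi.add_apply, Pi.smul_apply, id, hx0, zero_sub, norm_neg] at h1
  have h2 : δ ≤ ‖F x‖ := hmin hx
  have h3 : ‖(δ / (2 * r)) • x‖ ≤ δ / 2 := by
    rw [norm_smul, Real.norm_of_nonneg (by positivity)]
    have : ‖x‖ ≤ r := by simpa using hx
    calc δ / (2 * r) * ‖x‖ ≤ δ / (2 * r) * r := by gcongr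
      _ = δ / 2 := by field_simp
  have h4 := norm_sub_le (F x + (δ / (2 * r)) • x) ((δ / (2 * r)) • x)
  rw [add_sub_cancel_right] at h4
  linarith

end Retraction

/-! ### Sequential compactness in weak topologies. -/

section WeakSequences

variable {E : Type*} [NormedAddCommGroup E] [NormedSpace ℝ E]

theorem weaklyConverges_iff {u : ℕ → E} {a : E} :
    WeaklyConverges u a ↔
      ∀ η : StrongDual ℝ E, Tendsto (fun m => η (u m)) atTop (𝓝 (η a)) := by
  have h : Topology.IsInducing fun (x : WeakSpace ℝ E) (η : StrongDual ℝ E) =>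
    (topDualPairing ℝ E).flip x η := ⟨rfl⟩
  unfold WeaklyConverges
  rw [h.tendsto_nhds_iff, tendsto_pi_nhds]
  rfl

theorem Filter.Tendsto.weaklyConverges {u : ℕ → E} {a : E} (h : Tendsto u atTop (𝓝 a)) :
    WeaklyConverges u a :=
  weaklyConverges_iff.2 fun η => (η.continuous.tendsto a).comp h

/-- Norming functionals of a dense sequence separate points, and still do so after a perturbation
into `D` of norm below `1/4`. -/
theorem exists_seq_mem_separating_points [TopologicalSpace.SeparableSpace E]
    {D : Set (StrongDual ℝ E)} (hD : Dense D) :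
    ∃ η : ℕ → StrongDual ℝ E, (∀ n, η n ∈ D) ∧ ∀ x, (∀ n, η n x = 0) → x = 0 := by
  have key : ∀ n, ∃ η ∈ D, ∃ θ : StrongDual ℝ E, ‖η - θ‖ < 1 / 4 ∧ ‖θ‖ ≤ 1 ∧
      θ (TopologicalSpace.denseSeq E n) = ‖TopologicalSpace.denseSeq E n‖ := fun n => by
    obtain ⟨θ, hθ, hθn⟩ := exists_dual_vector'' ℝ (TopologicalSpace.denseSeq E n)
    obtain ⟨η, hη, hηθ⟩ := hD.exists_dist_lt θ (ε := 1 / 4) (by norm_num)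
    exact ⟨η, hη, θ, by rwa [dist_comm, dist_eq_norm] at hηθ, hθ, hθn⟩
  choose η hη θ hηθ hθ hθn using key
  refine ⟨η, hη, fun x hx => ?_⟩
  by_contra hx0
  have hpos : 0 < ‖x‖ := norm_pos_iff.2 hx0
  obtain ⟨n, hn⟩ := (TopologicalSpace.denseRange_denseSeq E).exists_dist_lt x
    (ε := ‖x‖ / 4) (by positivity)
  rw [dist_eq_norm] at hn
  set d := TopologicalSpace.denseSeq E n
  have h1 : ‖(η n - θ n) x‖ ≤ 1 / 4 * ‖x‖ :=
    ((η n - θ n).le_opNorm x).trans (by gcongr; exact (hηθ n).le)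
  have h2 : ‖θ n (x - d)‖ ≤ ‖x - d‖ := by
    simpa using (θ n).le_of_opNorm_le (hθ n) (x - d)
  have h3 : ‖x‖ ≤ ‖d‖ + ‖x - d‖ := by simpa using norm_add_le d (x - d)
  rw [_root_.sub_apply, hx n, Real.norm_eq_abs] at h1
  rw [map_sub, hθn n, Real.norm_eq_abs] at h2
  have := abs_le.1 h1
  have := abs_le.1 h2
  linarith

/-- The elementary half of the **Eberlein–Šmulian theorem**: a weakly compact set is weakly
sequentially compact. -/
theorem IsCompact.exists_subseq_weaklyConverges {K : Set (WeakSpace ℝ E)} (hK : IsCompact K)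
    {u : ℕ → E} (hu : ∀ n, toWeakSpace ℝ E (u n) ∈ K) :
    ∃ a, toWeakSpace ℝ E a ∈ K ∧
      ∃ k : ℕ → ℕ, StrictMono k ∧ WeaklyConverges (fun m => u (k m)) a := by
  set S := (Submodule.span ℝ (range u)).topologicalClosure with hS
  have hSclosed : IsClosed (S : Set E) := Submodule.isClosed_topologicalClosure _
  have : TopologicalSpace.SeparableSpace S :=
    ((countable_range u).isSeparable.span (R := ℝ)).closure.separableSpace
  obtain ⟨η, -, hη⟩ := exists_seq_mem_separating_points (E := S) dense_univ
  choose θ hθ _ using fun n => exists_extension_norm_eq S (η n)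
  set K' : Set (WeakSpace ℝ E) := K ∩ toWeakSpace ℝ E '' S with hK'
  have hweak : IsClosed (toWeakSpace ℝ E '' (S : Set E)) := by
    rw [← hSclosed.closure_eq, S.convex.toWeakSpace_closure ℝ]
    exact isClosed_closure
  have hcpt : IsCompact K' := hK.inter_right hweak
  have : CompactSpace K' := isCompact_iff_compactSpace.1 hcpt
  have hcont : ∀ n, Continuous fun x : K' => θ n ((toWeakSpace ℝ E).symm x.1) := fun n =>
    (WeakBilin.eval_continuous (topDualPairing ℝ E).flip (θ n)).comp continuous_subtype_val
  -- Countably many functionals separate the separable space `S`, so the compact set `K'` is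
  -- metrizable.
  have : TopologicalSpace.MetrizableSpace K' := by
    refine Metric.PiNatEmbed.TopologicalSpace.MetrizableSpace.of_countable_separating
      (fun n (x : K') => θ n ((toWeakSpace ℝ E).symm x.1)) hcont ?_
    rintro ⟨_, hxK, x, hx, rfl⟩ ⟨_, hyK, y, hy, rfl⟩
    contrapose!
    intro hall
    have : (⟨x - y, S.sub_mem hx hy⟩ : S) = 0 := hη _ fun n => by
      rw [← hθ n]
      simpa [sub_eq_zero] using hall n
    have h0 : x - y = 0 := congrArg Subtype.val this
    simp [sub_eq_zero.1 h0]
  have huS : ∀ n, u n ∈ S := fun n =>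
    Submodule.le_topologicalClosure _ (Submodule.subset_span (mem_range_self n))
  obtain ⟨a, k, hk, hka⟩ := CompactSpace.tendsto_subseq
    (fun n => (⟨toWeakSpace ℝ E (u n), hu n, u n, huS n, rfl⟩ : K'))
  refine ⟨(toWeakSpace ℝ E).symm a.1, by simpa using a.2.1, k, hk, ?_⟩
  unfold WeaklyConverges
  rw [LinearEquiv.apply_symm_apply]
  exact (continuous_subtype_val.tendsto a).comp hka

/-- Sequential Banach–Alaoglu; reflexivity turns weak-* convergence into weak convergence. -/
theorem exists_subseq_weaklyConverges_of_bounded_dual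
    (hE : Function.Surjective (NormedSpace.inclusionInDoubleDual ℝ E))
    [TopologicalSpace.SeparableSpace E] {η : ℕ → StrongDual ℝ E} {C : ℝ} (hη : ∀ n, ‖η n‖ ≤ C) :
    ∃ θ : StrongDual ℝ E, ∃ k : ℕ → ℕ, StrictMono k ∧ WeaklyConverges (fun m => η (k m)) θ := by
  obtain ⟨θ, -, k, hk, hlim⟩ := WeakDual.isSeqCompact_closedBall ℝ E 0 C
    (x := fun n => StrongDual.toWeakDual (η n)) (fun n => by simpa using hη n)
  refine ⟨WeakDual.toStrongDual θ, k, hk, weaklyConverges_iff.2 fun Θ => ?_⟩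
  obtain ⟨x, rfl⟩ := hE Θ
  exact ((WeakDual.eval_continuous x).tendsto θ).comp hlim

end WeakSequences

/-! ### The finite-dimensional equation. -/

section Galerkin

variable {V Y : Type*} [NormedAddCommGroup V] [InnerProductSpace ℝ V] [FiniteDimensional ℝ V]
  [NormedAddCommGroup Y] [NormedSpace ℝ Y]

theorem exists_forall_pairing_eq_zero (T : V →ₗ[ℝ] StrongDual ℝ Y) {v : V → Y}
    (hv : ∀ η : StrongDual ℝ Y, Continuous fun c => η (v c)) {r : ℝ} (hr : 0 < r)
    (h : ∀ c, ‖c‖ = r → 0 ≤ T c (v c)) : ∃ c, ∀ c', T c' (v c) = 0 := by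
  let b := stdOrthonormalBasis ℝ V
  -- The Riesz representative of `c' ↦ T c' (v c)`.
  let F : V → V := fun c => ∑ i, T (b i) (v c) • b i
  have hF : Continuous F := continuous_finsetSum _ fun i _ => (hv (T (b i))).smul continuous_const
  have hinner : ∀ c c', inner ℝ (F c) c' = T c' (v c) := fun c c' => by
    conv_rhs => rw [← b.sum_repr' c']
    simp only [F, sum_inner, real_inner_smul_left, map_sum, map_smul, _root_.sum_apply,
      _root_.smul_apply, smul_eq_mul, mul_comm]
  obtain ⟨c, -, hc⟩ := hF.exists_zero_of_inner_nonneg_on_sphere hr fun c hc => by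
    rw [hinner]; exact h c hc
  exact ⟨c, fun c' => by rw [← hinner, hc, inner_zero_left]⟩

end Galerkin

/-! ### Weak compactness and growth in `pn`-spaces. -/

namespace PNSpace

variable {X Z B : Type*} [AddCommGroup X] [Module ℝ X]
  [AddCommGroup Z] [Module ℝ Z] [TopologicalSpace Z]
  [NormedAddCommGroup B] [NormedSpace ℝ B]

theorem strictMono_gauge (M : PNSpace X Z B) : StrictMono M.gauge := by
  rcases M.gauge.continuous.strictMono_of_inj M.gauge.injective with h | h
  · exact h
  · have := h (zero_lt_one : (0 : ℝ≥0) < 1)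
    rw [M.gauge_zero] at this
    exact absurd this not_lt_zero

theorem gauge_pnorm (M : PNSpace X Z B) (x : M.Pt) : M.gauge (M.pnorm x) = ‖M.toB x‖₊ :=
  M.gauge.apply_symm_apply _

theorem pnorm_le_iff (M : PNSpace X Z B) (x : M.Pt) (R : ℝ≥0) :
    M.pnorm x ≤ R ↔ ‖M.toB x‖₊ ≤ M.gauge R := by
  rw [← M.gauge_pnorm, M.strictMono_gauge.le_iff_le]

theorem le_pnorm_iff (M : PNSpace X Z B) (x : M.Pt) (R : ℝ≥0) :
    R ≤ M.pnorm x ↔ M.gauge R ≤ ‖M.toB x‖₊ := by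
  rw [← M.gauge_pnorm, M.strictMono_gauge.le_iff_le]

theorem isometry_toB (M : PNSpace X Z B) : Isometry M.toB := fun _ _ => rfl

theorem eq_zero_of_toB_eq_zero (M : PNSpace X Z B) {x : M.Pt} (h : M.toB x = 0) : x.1 = 0 := by
  apply M.gen_injOn x.2.1 M.zero_mem_dom
  rw [← M.incl_toB x, h, map_zero, M.gen_zero]

theorem weakConv_of_tendsto (M : PNSpace X Z B) {u : ℕ → M.Pt} {a : M.Pt}
    (h : Tendsto u atTop (𝓝 a)) : M.WeakConv u a :=
  (M.weakConv_iff u a).2 ((M.isometry_toB.continuous.tendsto a).comp h).weaklyConverges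

theorem IsReflexive.exists_subseq_weakConv {M : PNSpace X Z B} (hM : M.IsReflexive) {u : ℕ → M.Pt}
    {R : ℝ≥0} (hu : ∀ n, M.pnorm (u n) ≤ R) :
    ∃ a, ∃ k : ℕ → ℕ, StrictMono k ∧ M.WeakConv (fun m => u (k m)) a := by
  let A : Set M.Pt := {x | M.pnorm x ≤ R}
  -- A closed convex set is weakly closed.
  have hball : IsClosed (toWeakSpace ℝ B '' Metric.closedBall (0 : B) (M.gauge R)) := by
    rw [← (Metric.isClosed_closedBall (x := (0 : B)) (ε := M.gauge R)).closure_eq,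
      (convex_closedBall (0 : B) (M.gauge R : ℝ)).toWeakSpace_closure ℝ]
    exact isClosed_closure
  have hA : IsClosed[M.weakTopology] A := by
    refine isClosed_induced_iff.2 ⟨_, hball, ?_⟩
    ext x
    simp [A, M.pnorm_le_iff, ← NNReal.coe_le_coe]
  have hcpt := @IsCompact.image _ _ M.weakTopology _ _ _ (hM A ⟨R, fun x hx => hx⟩ hA)
    (continuous_induced_dom (f := fun x : M.Pt => toWeakSpace ℝ B (M.toB x)))
  obtain ⟨b, ⟨a, -, hab⟩, k, hk, hlim⟩ := hcpt.exists_subseq_weaklyConverges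
    (u := fun n => M.toB (u n)) fun n => ⟨u n, hu n, rfl⟩
  refine ⟨a, k, hk, (M.weakConv_iff _ _).2 ?_⟩
  rwa [(toWeakSpace ℝ B).injective hab]

end PNSpace

theorem GrowthFunction.tendsto_zero {ν : ℝ → ℝ≥0∞} {K : ℝ≥0∞} (h : GrowthFunction ν K) :
    Tendsto ν (𝓝[≠] 0) (𝓝 0) := by
  obtain ⟨c₀, c₁, hc, h0, -⟩ := h.limits
  have hc0 : c₀ < 2 := by rcases hc with ⟨rfl, -⟩ | ⟨rfl, -⟩ <;> norm_num
  have hlim : Tendsto (fun l : ℝ => 2 * ENNReal.ofReal |l|) (𝓝[≠] 0) (𝓝 0) := by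
    have : Continuous fun l : ℝ => 2 * ENNReal.ofReal |l| :=
      ENNReal.continuous_const_mul (by norm_num) |>.comp
        (ENNReal.continuous_ofReal.comp continuous_abs)
    simpa using (this.tendsto 0).mono_left nhdsWithin_le_nhds
  refine tendsto_of_tendsto_of_tendsto_of_le_of_le' tendsto_const_nhds hlim
    (Eventually.of_forall fun _ => zero_le) ?_
  filter_upwards [h0.eventually (gt_mem_nhds hc0), self_mem_nhdsWithin] with l hl hl0
  have hl0' : ENNReal.ofReal |l| ≠ 0 := by simpa using hl0
  exact (ENNReal.div_le_iff hl0' ENNReal.ofReal_ne_top).1 hl.le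

/-- The growth inequality is used backwards: `x = s • z` with `s = l⁻¹` gives `δ ≤ ν(s)‖G z‖`, and
`ν(s)` is small. The same `l` serves all `x`. -/
theorem PNSpace.exists_smul_norm_le {X Z B : Type*} [AddCommGroup X] [Module ℝ X]
    [AddCommGroup Z] [Module ℝ Z] [TopologicalSpace Z]
    [NormedAddCommGroup B] [NormedSpace ℝ B] (M : PNSpace X Z B) {δ : ℝ} (hδ : 0 < δ) (N : ℝ≥0) :
    ∃ l : ℝ, 0 < l ∧ ∀ x z : M.Pt, z.1 = l • x.1 → δ ≤ ‖M.toB x‖ → N ≤ ‖M.toB z‖₊ := by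
  obtain ⟨ν, K, hν, hG⟩ := M.gen_smul
  have hδN : (0 : ℝ≥0∞) < ENNReal.ofReal (δ / (N + 1)) := by
    rw [ENNReal.ofReal_pos]; positivity
  have hev : ∀ᶠ l in 𝓝[>] (0 : ℝ), ν l < ENNReal.ofReal (δ / (N + 1)) :=
    (hν.tendsto_zero.mono_left (nhdsWithin_mono _ fun _ h => ne_of_gt h)).eventually
      (gt_mem_nhds hδN)
  obtain ⟨s, hs, hs0⟩ := (hev.and self_mem_nhdsWithin).exists
  have hs0 : 0 < s := hs0
  refine ⟨s⁻¹, inv_pos.2 hs0, fun x z hz hx => ?_⟩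
  by_contra! hlt
  have hfin : ν s * ‖M.toB z‖ₑ ≠ ∞ := ENNReal.mul_ne_top (hs.trans ENNReal.ofReal_lt_top).ne
    enorm_ne_top
  obtain ⟨-, b, hb, hle⟩ := hG z.1 z.2.1 (M.toB z) (M.incl_toB z) s hfin
  rw [hz, smul_inv_smul₀ hs0.ne', ← M.incl_toB x] at hb
  rw [M.incl_injective hb] at hle
  have h1 : ‖M.toB x‖ₑ ≤ ENNReal.ofReal (δ / (N + 1)) * N :=
    hle.trans (mul_le_mul' hs.le (by rw [enorm_eq_nnnorm]; exact_mod_cast hlt.le))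
  rw [← ofReal_norm, ← ENNReal.ofReal_coe_nnreal,
    ← ENNReal.ofReal_mul (by positivity), ENNReal.ofReal_le_ofReal_iff (by positivity)] at h1
  have h2 : δ / (N + 1) * N < δ := by
    rw [div_mul_eq_mul_div, div_lt_iff₀ (by positivity)]
    nlinarith
  linarith

/-! ### Galerkin approximations and passage to the limit. -/

section Solution

variable {X Z B Y E₀ : Type*} [AddCommGroup X] [Module ℝ X]
  [AddCommGroup Z] [Module ℝ Z] [TopologicalSpace Z]
  [NormedAddCommGroup B] [NormedSpace ℝ B]
  [NormedAddCommGroup Y] [NormedSpace ℝ Y] [TopologicalSpace E₀]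

theorem CoercivePair.exists_forall_pairing_pos {M : PNSpace X Z B} {f : M.Pt → Y} {j : E₀ → X}
    {g : E₀ → StrongDual ℝ Y} {X₁ : Set E₀} {φ : ℝ≥0 → ℝ} (h : CoercivePair M f j g X₁ φ)
    {φ₁ : ℝ≥0 → ℝ≥0} (hgφ₁ : ∀ (e : E₀) (x : M.Pt), x.1 = j e → ‖g e‖ ≤ φ₁ (M.pnorm x))
    (hφφ₁ : Tendsto (fun τ : ℝ≥0 => φ τ * τ / φ₁ τ) atTop atTop) (y : Y) :
    ∃ R : ℝ≥0, ∀ e ∈ X₁, ∀ x : M.Pt, x.1 = j e → R ≤ M.pnorm x → 0 < g e (f x - y) := by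
  obtain ⟨R, hR⟩ := eventually_atTop.1 (hφφ₁.eventually_gt_atTop ‖y‖)
  refine ⟨R, fun e he x hx hRx => ?_⟩
  have h1 := hR _ hRx
  have hφ₁ : (0 : ℝ) < φ₁ (M.pnorm x) := by
    -- If `φ₁` vanished, the quotient would be `0` by convention, not above `‖y‖`.
    refine lt_of_le_of_ne NNReal.zero_le_coe fun h0 => ?_
    rw [← h0, div_zero] at h1
    exact absurd h1 (norm_nonneg y).not_gt
  rw [lt_div_iff₀ hφ₁] at h1
  have h2 : g e y ≤ φ₁ (M.pnorm x) * ‖y‖ :=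
    (le_abs_self _).trans ((g e).le_of_opNorm_le (hgφ₁ e x hx) y)
  have h3 := h.coercive e he x hx
  rw [map_sub]
  linarith

/-- Subsequences suffice: the limit is prescribed, so a convergent sub-subsequence in every
subsequence gives convergence of the whole sequence. -/
theorem WeaklyCompactMap.continuous_pairing {M : PNSpace X Z B} {f : M.Pt → Y}
    (hf : WeaklyCompactMap M f) {V : Type*} [TopologicalSpace V] [SequentialSpace V] {x : V → M.Pt}
    (hx : ∀ (c : ℕ → V) (c₀ : V), Tendsto c atTop (𝓝 c₀) →
      ∃ k : ℕ → ℕ, StrictMono k ∧ M.WeakConv (fun m => x (c (k m))) (x c₀))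
    (η : StrongDual ℝ Y) : Continuous fun c => η (f (x c)) := by
  refine continuous_iff_seqContinuous.2 fun c c₀ hc => ?_
  refine tendsto_of_subseq_tendsto fun ns hns => ?_
  obtain ⟨k, -, hk⟩ := hx (fun m => c (ns m)) c₀ (hc.comp hns)
  obtain ⟨l, -, hl⟩ := hf _ _ hk
  exact ⟨fun m => k (l m), weaklyConverges_iff.1 hl η⟩

/-- The Galerkin step on the finite-dimensional space `V`, for approximations with values in the
domain of the weakly compact mapping `f`. -/
theorem WeaklyCompactMap.exists_galerkin_solution {M : PNSpace X Z B} {f : M.Pt → Y} {E : Type*} {j : E → X}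
    {g : E → StrongDual ℝ Y} {X₁ : Set E} (hf : WeaklyCompactMap M f) {y : Y} {R : ℝ≥0}
    (hR : ∀ e ∈ X₁, ∀ x : M.Pt, x.1 = j e → R ≤ M.pnorm x → 0 < g e (f x - y))
    {V : Type*} [NormedAddCommGroup V] [InnerProductSpace ℝ V] [FiniteDimensional ℝ V]
    (T : V →ₗ[ℝ] StrongDual ℝ Y) {e : V → E} {x : V → M.Pt} (he : ∀ c, e c ∈ X₁)
    (hge : ∀ c, g (e c) = T c) (hxe : ∀ c, (x c).1 = j (e c))
    (hx : ∀ (c : ℕ → V) (c₀ : V), Tendsto c atTop (𝓝 c₀) →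
      ∃ k : ℕ → ℕ, StrictMono k ∧ M.WeakConv (fun m => x (c (k m))) (x c₀))
    {r : ℝ} (hr : 0 < r) (hrR : ∀ c, ‖c‖ = r → R ≤ M.pnorm (x c)) :
    ∃ c, M.pnorm (x c) ≤ R ∧ ∀ c', T c' (f (x c) - y) = 0 := by
  obtain ⟨c, hc⟩ := exists_forall_pairing_eq_zero T (v := fun c => f (x c) - y)
    (fun η => by
      simp only [map_sub]
      exact (hf.continuous_pairing hx η).sub continuous_const) hr
    fun c hc => by
      rw [← hge]
      exact (hR _ (he c) _ (hxe c) (hrR c hc)).le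
  refine ⟨c, ?_, hc⟩
  by_contra! hlt
  have := hR _ (he c) _ (hxe c) hlt.le
  rw [hge, hc c] at this
  exact lt_irrefl _ this

theorem WeaklyCompactMap.pairing_eq_zero_of_weakConv {M : PNSpace X Z B} {f : M.Pt → Y}
    (hf : WeaklyCompactMap M f) {y : Y} {η : ℕ → StrongDual ℝ Y} {x : ℕ → M.Pt}
    (hx : ∀ n, ∀ i < n, η i (f (x n) - y) = 0) {k : ℕ → ℕ} (hk : StrictMono k) {x₀ : M.Pt}
    (hlim : M.WeakConv (fun m => x (k m)) x₀) (i : ℕ) : η i (f x₀ - y) = 0 := by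
  obtain ⟨l, hl, hfl⟩ := hf _ _ hlim
  have h1 : Tendsto (fun m => η i (f (x (k (l m))) - y)) atTop (𝓝 (η i (f x₀ - y))) := by
    simp only [map_sub]
    exact (weaklyConverges_iff.1 hfl (η i)).sub tendsto_const_nhds
  refine tendsto_nhds_unique h1 (tendsto_const_nhds.congr' ?_)
  filter_upwards [(hk.comp hl).tendsto_atTop.eventually_gt_atTop i] with m hm
  exact (hx _ i hm).symm

theorem LinearAlternative.exists_eq {M : PNSpace X Z B} {f : M.Pt → Y} {j : E₀ → X}
    {g : E₀ → StrongDual ℝ Y} {X₁ : Set E₀} (hg : LinearAlternative M j g X₁)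
    (hj : Function.Injective j) (hf : WeaklyCompactMap M f) {y : Y} {R : ℝ≥0}
    (hR : ∀ e ∈ X₁, ∀ x : M.Pt, x.1 = j e → R ≤ M.pnorm x → 0 < g e (f x - y)) :
    ∃ x : M.Pt, f x = y := by
  obtain ⟨hrefl, rfl, ⟨ι, hι, hιj⟩, hsep, hgrp, hmod, htop, hsmul, hjlin, L, hL, hker⟩ := hg
  have hιinj : Function.Injective ι := fun a b hab => hj (by rw [← hιj, ← hιj, hab])
  -- Needed to identify finite-dimensional subspaces of `E₀` topologically with Euclidean spaces.
  have : T2Space E₀ := T2Space.of_injective_continuous hιinj hι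
  have hne : Nonempty E₀ := ⟨0⟩
  let d := TopologicalSpace.denseSeq E₀
  have step : ∀ n : ℕ, ∃ x : M.Pt, M.pnorm x ≤ R ∧ ∀ i < n, L (d i) (f x - y) = 0 := by
    intro n
    let W : Submodule ℝ E₀ := Submodule.span ℝ (d '' Iio n)
    have : FiniteDimensional ℝ W := FiniteDimensional.span_of_finite ℝ ((finite_Iio n).image d)
    let u := (toEuclidean (E := W)).symm
    have hcont : Continuous fun c => ι (u c : E₀) :=
      hι.comp (continuous_subtype_val.comp u.continuous)
    -- Compactness of the unit sphere, which is empty if `W = 0`.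
    obtain ⟨δ, hδ, hδle⟩ : ∃ δ : ℝ, 0 < δ ∧ ∀ c, ‖c‖ = 1 → δ ≤ ‖M.toB (ι (u c : E₀))‖ := by
      rcases (Metric.sphere (0 : EuclideanSpace ℝ (Fin (Module.finrank ℝ W))) 1).eq_empty_or_nonempty
        with hemp | hnon
      · refine ⟨1, one_pos, fun c hc => ?_⟩
        have : c ∈ Metric.sphere (0 : EuclideanSpace ℝ (Fin (Module.finrank ℝ W))) 1 := by simpa
        rw [hemp] at this
        exact this.elim
      · obtain ⟨c₀, hc₀, hmin⟩ := (isCompact_sphere _ _).exists_isMinOn hnon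
          (M.isometry_toB.continuous.comp hcont).norm.continuousOn
        refine ⟨‖M.toB (ι (u c₀ : E₀))‖, norm_pos_iff.2 fun h0 => ?_, fun c hc => hmin (by simpa)⟩
        have h1 : j (u c₀ : E₀) = j 0 := by
          rw [← hιj, M.eq_zero_of_toB_eq_zero h0, hjlin.map_zero]
        have h2 : u c₀ = 0 := Subtype.ext (hj h1)
        have h3 : c₀ = 0 := by simpa using h2
        simp [h3] at hc₀
    obtain ⟨l, hl, hlN⟩ := M.exists_smul_norm_le hδ (M.gauge R)
    obtain ⟨c, hc, hc0⟩ := WeaklyCompactMap.exists_galerkin_solution hf hR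
      ((L : E₀ →ₗ[ℝ] StrongDual ℝ Y) ∘ₗ W.subtype ∘ₗ (u : _ →ₗ[ℝ] W))
      (e := fun c => (u c : E₀)) (x := fun c => ι (u c : E₀)) (fun _ => mem_univ _)
      (fun c => (hL _).symm) (fun c => hιj _)
      (fun c c₀ hc => ⟨id, strictMono_id, M.weakConv_of_tendsto ((hcont.tendsto c₀).comp hc)⟩) hl
      (fun c hc => by
        rw [M.le_pnorm_iff]
        refine hlN (ι (u (l⁻¹ • c) : E₀)) _ ?_ (hδle _ ?_)
        · rw [hιj, hιj, ← hjlin.map_smul, map_smul, Submodule.coe_smul, smul_inv_smul₀ hl.ne']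
        · rw [norm_smul, hc, Real.norm_of_nonneg (inv_pos.2 hl).le, inv_mul_cancel₀ hl.ne'])
    refine ⟨ι (u c : E₀), hc, fun i hi => ?_⟩
    simpa [u] using hc0 (toEuclidean (⟨d i, Submodule.subset_span ⟨i, hi, rfl⟩⟩ : W))
  choose x hxR hx using step
  obtain ⟨x₀, k, hk, hlim⟩ := hrefl.exists_subseq_weakConv hxR
  have hzero := hf.pairing_eq_zero_of_weakConv (η := fun i => L (d i)) hx hk hlim
  refine ⟨x₀, sub_eq_zero.1 (hker _ fun e => ?_)⟩
  have hc : Continuous fun e => L e (f x₀ - y) :=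
    (ContinuousLinearMap.apply ℝ ℝ (f x₀ - y)).continuous.comp L.continuous
  exact congrFun ((TopologicalSpace.denseRange_denseSeq E₀).equalizer hc continuous_const
    (funext hzero)) e

theorem NonlinearAlternative.exists_eq {M : PNSpace X Z B} {f : M.Pt → Y} {E : Type*} {j : E → X}
    {g : E → StrongDual ℝ Y} {X₁ : Set E} (hg : NonlinearAlternative M j g X₁)
    (hX₁ : ∀ e ∈ X₁, j e ∈ M.carrier) (hf : WeaklyCompactMap M f) {y : Y} {R : ℝ≥0}
    (hR : ∀ e ∈ X₁, ∀ x : M.Pt, x.1 = j e → R ≤ M.pnorm x → 0 < g e (f x - y))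
    {φ₁ : ℝ≥0 → ℝ≥0} (hφ₁ : Continuous φ₁)
    (hgφ₁ : ∀ (e : E) (x : M.Pt), x.1 = j e → ‖g e‖ ≤ φ₁ (M.pnorm x)) :
    ∃ x : M.Pt, f x = y := by
  obtain ⟨hrefl, hsep, ⟨D, hD, hDg⟩, -, hcomp⟩ := hg
  obtain ⟨η, hηD, hη⟩ := exists_seq_mem_separating_points hD
  obtain ⟨C, hC⟩ : ∃ C : ℝ≥0, ∀ τ ≤ R, φ₁ τ ≤ C := by
    obtain ⟨C, hC⟩ := (isCompact_Icc (a := (0 : ℝ≥0)) (b := R)).bddAbove_image hφ₁.continuousOn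
    exact ⟨C, fun τ hτ => hC (mem_image_of_mem _ ⟨zero_le, hτ⟩)⟩
  have hbound : ∀ (e : E) (x : M.Pt), x.1 = j e → M.pnorm x ≤ R → ‖g e‖ ≤ C :=
    fun e x hx hxR => (hgφ₁ e x hx).trans (by exact_mod_cast hC _ hxR)
  have step : ∀ n : ℕ, ∃ (e : E) (x : M.Pt), e ∈ X₁ ∧ x.1 = j e ∧ M.pnorm x ≤ R ∧
      ∀ i < n, η i (f x - y) = 0 := by
    intro n
    let W : Submodule ℝ (StrongDual ℝ Y) := Submodule.span ℝ (η '' Iio n)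
    have : FiniteDimensional ℝ W := FiniteDimensional.span_of_finite ℝ ((finite_Iio n).image η)
    have hWD : W ≤ D := Submodule.span_le.2 (by rintro _ ⟨i, -, rfl⟩; exact hηD i)
    let u := (toEuclidean (E := W)).symm
    let T : EuclideanSpace ℝ (Fin (Module.finrank ℝ W)) →ₗ[ℝ] StrongDual ℝ Y :=
      W.subtype ∘ₗ (u : _ →ₗ[ℝ] W)
    -- No continuity of this choice is known; weak compactness of `g⁻¹` supplies the subsequential
    -- substitute.
    choose e he hge using fun c => hDg (hWD (u c).2)
    let x : EuclideanSpace ℝ (Fin (Module.finrank ℝ W)) → M.Pt := fun c => ⟨j (e c), hX₁ _ (he c)⟩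
    -- `[x c] ≤ R` forces `‖T c‖ ≤ C`, hence `‖c‖ ≤ r`; so `[x c] > R` on the sphere of radius `r +
    -- 1`.
    obtain ⟨r, hr, hrC⟩ := ((isCompact_closedBall (0 : W) C).image
      (toEuclidean (E := W)).continuous).isBounded.exists_pos_norm_le
    obtain ⟨c, hc, hc0⟩ := WeaklyCompactMap.exists_galerkin_solution hf hR
      T (e := e) (x := x) he hge (fun _ => rfl)
      (fun c c₀ hc => by
        have hlim : Tendsto (fun m => g (e (c m))) atTop (𝓝 (u c₀ : StrongDual ℝ Y)) := by
          simp only [hge]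
          exact ((continuous_subtype_val.comp u.continuous).tendsto c₀).comp hc
        obtain ⟨k, hk, x₀, hx₀, heq⟩ := hcomp (fun m => e (c m)) (fun m => x (c m)) _
          (fun m => ⟨he _, rfl⟩) hlim.weaklyConverges
        have : x₀ = x c₀ := Subtype.ext (heq _ (he c₀) (hge c₀))
        exact ⟨k, hk, this ▸ hx₀⟩) (r := r + 1) (by positivity)
      (fun c hc => by
        by_contra! hlt
        have h1 := hbound _ (x c) rfl hlt.le
        rw [hge] at h1
        have h2 := hrC c ⟨u c, mem_closedBall_zero_iff.2 h1, (toEuclidean (E := W)).apply_symm_apply c⟩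
        linarith)
    refine ⟨e c, x c, he c, rfl, hc, fun i hi => ?_⟩
    simpa [T, u] using hc0 (toEuclidean (⟨η i, Submodule.subset_span ⟨i, hi, rfl⟩⟩ : W))
  choose e x he hxe hxR hx using step
  obtain ⟨θ, k, hk, hθ⟩ := exists_subseq_weaklyConverges_of_bounded_dual hrefl
    (fun n => hbound _ _ (hxe n) (hxR n))
  -- `θ` need not lie in `g(X₁)`; only the existence of a weak limit in `𝓜₀` matters.
  obtain ⟨l, hl, x₀, hx₀, -⟩ := hcomp (fun m => e (k m)) (fun m => x (k m)) θ
    (fun m => ⟨he _, hxe _⟩) hθ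
  exact ⟨x₀, sub_eq_zero.1 (hη _
    (hf.pairing_eq_zero_of_weakConv hx (k := fun m => k (l m)) (hk.comp hl) hx₀))⟩

end Solution

theorem corollary1 {X Y Z B E₀ : Type*}
    [NormedAddCommGroup X] [NormedSpace ℝ X] [CompleteSpace X]
    [NormedAddCommGroup Y] [NormedSpace ℝ Y] [CompleteSpace Y]
    [AddCommGroup Z] [Module ℝ Z] [TopologicalSpace Z] [IsTopologicalAddGroup Z]
    [ContinuousSMul ℝ Z] [LocallyConvexSpace ℝ Z]
    [NormedAddCommGroup B] [NormedSpace ℝ B] [CompleteSpace B]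
    [TopologicalSpace E₀]
    (M₀ : PNSpace X Z B) (hM₀ : M₀.WeaklyComplete)
    (f : M₀.Pt → Y) (hf : WeaklyCompactMap M₀ f)
    (j : E₀ → X) (g : E₀ → StrongDual ℝ Y) (X₁ : Set E₀) (φ : ℝ≥0 → ℝ)
    (hfg : CoercivePair M₀ f j g X₁ φ)
    (hg : LinearAlternative M₀ j g X₁ ∨ NonlinearAlternative M₀ j g X₁)
    (φ₁ : ℝ≥0 → ℝ≥0) (hφ₁ : Continuous φ₁)
    (hgφ₁ : ∀ (e : E₀) (x : M₀.Pt), x.1 = j e → ‖g e‖ ≤ φ₁ (M₀.pnorm x))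
    (hφ : Tendsto φ atTop atTop)
    (hφφ₁ : Tendsto (fun τ : ℝ≥0 => φ τ * τ / φ₁ τ) atTop atTop) :
    ∀ y : Y, ∃ x : M₀.Pt, ∀ η : StrongDual ℝ Y, η (f x) = η y := by
  intro y
  obtain ⟨R, hR⟩ := hfg.exists_forall_pairing_pos hgφ₁ hφφ₁ y
  obtain ⟨x, hx⟩ : ∃ x : M₀.Pt, f x = y := hg.elim
    (fun h => h.exists_eq hfg.incl_injective hf hR)
    (fun h => h.exists_eq hfg.subset hf hR hφ₁ hgφ₁)
  exact ⟨x, fun η => by rw [hx]⟩
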